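/- A weighted multigraph $(G,\upsilon,\varepsilon)$ is a finite graph $G=(V,E)$, possibly with loops and multiple edges, with weights $\upsilon:V\to\mathbb R_{>0}$ and $\varepsilon:E\to\mathbb R_{>0}$. Its weighted Laplacian is the linear operator on functions $f:V\to\mathbb R$ given by $$(Lf)(v)=\frac1{\upsilon(v)}\sum_{uv\in E,\ u\ne v}\varepsilon(uv)\,(f(v)-f(u))\qquad(v\in V).$$ All rectangles are in the plane, have positive width $w$ and height $h$, and have sides parallel to the axes. A rectangular tiling of a rectangle $R$ is a subdivision of $R$ into finitely many rectangles with pairwise disjoint interiors. Its associated edge-weighted graph has as vertices the horizontal lines that contain a horizontal side of some tile, and as edges the tiles; a tile $r$ joins the lines containing its bottom and top sides and has edge weight $w(r)/h(r)$. **Theorem.** Let $(G,\upsilon,\varepsilon)$ be a weighted multigraph with $n$ vertices, let $e=ab$ be an edge, let $R$ be a rectangle with $\varepsilon(e)=w(R)/h(R)$, and consider any rectangular tiling of $R$. Let $(G',\upsilon',\varepsilon')$ be the weighted multigraph obtained by replacing the edge $e$ with the edge-weighted graph associated with the tiling, identifying $a$ and $b$ with the vertices corresponding to the bottom and top sides of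 $R$, respectively; the old vertices and the other old edges keep their weights, and the $k$ new vertices get arbitrary positive weights. Then the weighted Laplacians of $(G,\upsilon,\varepsilon)$ and $(G',\upsilon',\varepsilon')$ have only real eigenvalues, and if these are, with multiplicity, $\lambda_1\le\dots\le\lambda_n$ and $\mu_1\le\dots\le\mu_{n+k}$, respectively, then $$\mu_i\le\lambda_i\le\mu_{i+k}\qquad\text{for all }1\le i\le n.$$ -/

import Mathlib

/-- A weighted multigraph with vertex set `V` and edge set `E`; loops and multiple edges are
allowed. The edge `e` joins `src e` and `tgt e`; which end is called the source is an arbitrary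
reference orientation, used only to write a vector field as a function `E → ℝ`. -/
structure WeightedMultigraph (V E : Type*) where
  src : E → V
  tgt : E → V
  vertexWeight : V → ℝ
  edgeWeight : E → ℝ
  vertexWeight_pos : ∀ v, 0 < vertexWeight v
  edgeWeight_pos : ∀ e, 0 < edgeWeight e

namespace WeightedMultigraph

variable {V E : Type*}

/-- The gradient `∇ : L²(V, υ) → L²(E, ε)`. A vector field `F` has the value `F e` times the unit
vector pointing from `src e` to `tgt e` on the edge `e`. -/
def grad (G : WeightedMultigraph V E) : (V → ℝ) →ₗ[ℝ] (E → ℝ) where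
  toFun f := fun e => f (G.tgt e) - f (G.src e)
  map_add' f g := by
    funext e
    simp only [Pi.add_apply]
    ring
  map_smul' c f := by
    funext e
    simp only [Pi.smul_apply, smul_eq_mul, RingHom.id_apply]
    ring

/-- The negative divergence `∂ : L²(E, ε) → L²(V, υ)`: at `v` it is the sum, over the nonloop
edges `uv`, of `ε(uv) / υ(v)` times the component of `F` in the direction from `u` to `v`. -/
noncomputable def negDiv [Fintype E] [DecidableEq V] (G : WeightedMultigraph V E) :
    (E → ℝ) →ₗ[ℝ] (V → ℝ) where
  toFun F := fun v =>
    (∑ e : E, if G.tgt e = v ∧ G.src e ≠ v then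
      G.edgeWeight e / G.vertexWeight v * F e else 0) +
    (∑ e : E, if G.src e = v ∧ G.tgt e ≠ v then
      G.edgeWeight e / G.vertexWeight v * (-F e) else 0)
  map_add' F F' := by
    funext v
    simp only [Pi.add_apply, ← Finset.sum_add_distrib]
    refine Finset.sum_congr rfl fun e _ => ?_
    split_ifs <;> ring
  map_smul' c F := by
    funext v
    simp only [Pi.smul_apply, smul_eq_mul, RingHom.id_apply, ← Finset.sum_add_distrib,
      Finset.mul_sum]
    refine Finset.sum_congr rfl fun e _ => ?_
    split_ifs <;> ring

/-- The weighted Laplacian `L = ∂ ∇`. -/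
noncomputable def laplacian [Fintype E] [DecidableEq V] (G : WeightedMultigraph V E) :
    (V → ℝ) →ₗ[ℝ] (V → ℝ) :=
  G.negDiv ∘ₗ G.grad

/-- Where a vertex `x` of a graph with terminals `s`, `t` goes when `s` is identified with
`a : V` and `t` with `b : V`: the other vertices become new vertices. -/
def glue {U : Type*} [DecidableEq U] (a b : V) (s t x : U) :
    V ⊕ {x : U // x ≠ s ∧ x ≠ t} :=
  if hs : x = s then Sum.inl a
  else if ht : x = t then Sum.inl b
  else Sum.inr ⟨x, hs, ht⟩

/-- Replace the edge `e` of `G` by the edge-weighted graph underlying `H`, whose (distinct)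
terminals `s` and `t` are identified with the vertices `a` and `b` of `G`. The old vertices keep
their weights, the new vertices get the weights `w`; the vertex weights of `H` play no role. -/
def replaceEdge {U D : Type*} [DecidableEq U] (G : WeightedMultigraph V E) (e : E) (a b : V)
    (H : WeightedMultigraph U D) (s t : U)
    (w : {x : U // x ≠ s ∧ x ≠ t} → ℝ) (hw : ∀ x, 0 < w x) :
    WeightedMultigraph (V ⊕ {x : U // x ≠ s ∧ x ≠ t}) ({f : E // f ≠ e} ⊕ D) where
  src := Sum.elim (fun f => Sum.inl (G.src f)) (fun d => glue a b s t (H.src d))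
  tgt := Sum.elim (fun f => Sum.inl (G.tgt f)) (fun d => glue a b s t (H.tgt d))
  vertexWeight := Sum.elim G.vertexWeight w
  edgeWeight := Sum.elim (fun f => G.edgeWeight f) H.edgeWeight
  vertexWeight_pos := by
    rintro (v | x)
    · exact G.vertexWeight_pos v
    · exact hw x
  edgeWeight_pos := by
    rintro (f | d)
    · exact G.edgeWeight_pos f
    · exact H.edgeWeight_pos d

end WeightedMultigraph

/-- `ev 0 ≤ ev 1 ≤ …` is the complete list of the eigenvalues of `L` (all of them real), with
multiplicity. -/
def IsOrderedEigenvalueList {V : Type*} [Finite V] (L : (V → ℝ) →ₗ[ℝ] (V → ℝ)) {n : ℕ}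
    (ev : Fin n → ℝ) : Prop :=
  Monotone ev ∧ L.charpoly = ∏ i, (Polynomial.X - Polynomial.C (ev i))

/-- A rectangle in the plane with positive dimensions and sides parallel to the axes. -/
structure PlaneRect where
  left : ℝ
  right : ℝ
  bottom : ℝ
  top : ℝ
  left_lt_right : left < right
  bottom_lt_top : bottom < top

namespace PlaneRect

def width (r : PlaneRect) : ℝ := r.right - r.left

def height (r : PlaneRect) : ℝ := r.top - r.bottom

/-- The closed rectangle as a subset of the plane. -/
def toSet (r : PlaneRect) : Set (ℝ × ℝ) := Set.Icc r.left r.right ×ˢ Set.Icc r.bottom r.top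

end PlaneRect

/-- A tiling of the rectangle `R` by finitely many interior-disjoint rectangles. -/
structure RectTiling (R : PlaneRect) where
  tiles : Finset PlaneRect
  iUnion_eq : (⋃ r ∈ tiles, r.toSet) = R.toSet
  interior_disjoint : ∀ r ∈ tiles, ∀ r' ∈ tiles, r ≠ r' →
    Disjoint (interior r.toSet) (interior r'.toSet)

namespace RectTiling

variable {R : PlaneRect}

/-- The horizontal lines which cover some horizontal side of a tile, each line being given by its
`y`-coordinate. -/
noncomputable def lines (T : RectTiling R) : Finset ℝ :=
  T.tiles.image PlaneRect.bottom ∪ T.tiles.image PlaneRect.top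

theorem tile_subset (T : RectTiling R) {r : PlaneRect} (hr : r ∈ T.tiles) :
    r.toSet ⊆ R.toSet := by
  rw [← T.iUnion_eq]
  exact Set.subset_biUnion_of_mem (u := fun r : PlaneRect => r.toSet) hr

theorem bottom_mem_lines (T : RectTiling R) : R.bottom ∈ T.lines := by
  have h : (R.left, R.bottom) ∈ R.toSet :=
    ⟨⟨le_refl _, R.left_lt_right.le⟩, ⟨le_refl _, R.bottom_lt_top.le⟩⟩
  rw [← T.iUnion_eq] at h
  simp only [Set.mem_iUnion] at h
  obtain ⟨r, hr, h⟩ := h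
  have h' : (r.left, r.bottom) ∈ R.toSet := T.tile_subset hr
    ⟨⟨le_refl _, r.left_lt_right.le⟩, ⟨le_refl _, r.bottom_lt_top.le⟩⟩
  have hb : r.bottom = R.bottom := le_antisymm h.2.1 h'.2.1
  exact Finset.mem_union_left _ (Finset.mem_image.2 ⟨r, hr, hb⟩)

theorem top_mem_lines (T : RectTiling R) : R.top ∈ T.lines := by
  have h : (R.left, R.top) ∈ R.toSet :=
    ⟨⟨le_refl _, R.left_lt_right.le⟩, ⟨R.bottom_lt_top.le, le_refl _⟩⟩
  rw [← T.iUnion_eq] at h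
  simp only [Set.mem_iUnion] at h
  obtain ⟨r, hr, h⟩ := h
  have h' : (r.left, r.top) ∈ R.toSet := T.tile_subset hr
    ⟨⟨le_refl _, r.left_lt_right.le⟩, ⟨r.bottom_lt_top.le, le_refl _⟩⟩
  have hb : r.top = R.top := le_antisymm h'.2.2 h.2.2
  exact Finset.mem_union_right _ (Finset.mem_image.2 ⟨r, hr, hb⟩)

/-- The vertex corresponding to the bottom side of `R`. -/
noncomputable def bottomVertex (T : RectTiling R) : {y : ℝ // y ∈ T.lines} :=
  ⟨R.bottom, T.bottom_mem_lines⟩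

/-- The vertex corresponding to the top side of `R`. -/
noncomputable def topVertex (T : RectTiling R) : {y : ℝ // y ∈ T.lines} :=
  ⟨R.top, T.top_mem_lines⟩

/-- The edge-weighted graph associated with the tiling: the vertices are the horizontal lines,
the edges are the tiles, each joining the lines of its bottom and top sides and weighted by
width over height (all vertex weights are `1`). -/
noncomputable def graph (T : RectTiling R) :
    WeightedMultigraph {y : ℝ // y ∈ T.lines} {r : PlaneRect // r ∈ T.tiles} where
  src r := ⟨r.1.bottom, Finset.mem_union_left _ (Finset.mem_image_of_mem _ r.2)⟩
  tgt r := ⟨r.1.top, Finset.mem_union_right _ (Finset.mem_image_of_mem _ r.2)⟩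
  vertexWeight _ := 1
  edgeWeight r := r.1.width / r.1.height
  vertexWeight_pos _ := one_pos
  edgeWeight_pos r := div_pos (sub_pos.2 r.1.left_lt_right) (sub_pos.2 r.1.bottom_lt_top)

/-- The vertices that are added when an edge is replaced by the graph of the tiling: the lines
other than those of the bottom and top sides of `R`. -/
abbrev NewVertex (T : RectTiling R) : Type :=
  {x : {y : ℝ // y ∈ T.lines} // x ≠ T.bottomVertex ∧ x ≠ T.topVertex}

end RectTiling

/-! By Green's formula the Laplacian is self-adjoint for the `υ`-weighted inner product, and its
quadratic form is the Dirichlet energy. The eigenvalues are therefore governed by the Rayleigh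
quotient energy/mass, and both inequalities follow by comparing quotients through an extension of
functions to the new vertices and counting dimensions. Interpolating affinely in the height
preserves energy, because the tile areas add up to the area of `R`, and does not decrease mass; this
gives `μ_i ≤ λ_i`. Extending by zero preserves mass and does not decrease energy, because the affine
potential has the least energy for given values on the bottom and top of `R` (`le_energy`, from
Kirchhoff's law `sum_width_mul_sub`); this gives `λ_i ≤ μ_{i+k}`. -/

/-! ### Flux and energy of potentials on a tiling. -/

theorem PlaneRect.convex_toSet (r : PlaneRect) : Convex ℝ r.toSet :=
  (convex_Icc _ _).prod (convex_Icc _ _)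

theorem PlaneRect.isCompact_toSet (r : PlaneRect) : IsCompact r.toSet :=
  isCompact_Icc.prod isCompact_Icc

/-- Rectangles with disjoint interiors overlap in a null set. -/
theorem PlaneRect.aedisjoint {r r' : PlaneRect}
    (h : Disjoint (interior r.toSet) (interior r'.toSet)) :
    MeasureTheory.AEDisjoint MeasureTheory.volume r.toSet r'.toSet := by
  have key : r.toSet ∩ r'.toSet ⊆ frontier r.toSet ∪ frontier r'.toSet := by
    rintro x ⟨hx, hx'⟩
    by_cases h1 : x ∈ interior r.toSet
    · refine Or.inr ⟨subset_closure hx', fun h2 => ?_⟩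
      exact Set.disjoint_left.1 h h1 h2
    · exact Or.inl ⟨subset_closure hx, h1⟩
  exact MeasureTheory.measure_mono_null key (MeasureTheory.measure_union_null
    (r.convex_toSet.addHaar_frontier _) (r'.convex_toSet.addHaar_frontier _))

/-- The integral over a rectangle of the `y`-derivative of a polynomial in `y`. -/
theorem PlaneRect.integral_derivative (r : PlaneRect) (p : Polynomial ℝ) :
    ∫ z in r.toSet, p.derivative.eval z.2 =
      r.width * (p.eval r.top - p.eval r.bottom) := by
  have hc : Continuous fun z : ℝ × ℝ => p.derivative.eval z.2 := by fun_prop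
  have hi : MeasureTheory.IntegrableOn (fun z : ℝ × ℝ => p.derivative.eval z.2) r.toSet :=
    hc.continuousOn.integrableOn_compact r.isCompact_toSet
  have h1 : ∫ y in Set.Icc r.bottom r.top, p.derivative.eval y =
      p.eval r.top - p.eval r.bottom := by
    rw [MeasureTheory.integral_Icc_eq_integral_Ioc,
      ← intervalIntegral.integral_of_le r.bottom_lt_top.le]
    exact intervalIntegral.integral_eq_sub_of_hasDerivAt (fun x _ => p.hasDerivAt x)
      (p.derivative.continuous.intervalIntegrable _ _)
  unfold PlaneRect.toSet at hi ⊢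
  rw [MeasureTheory.Measure.volume_eq_prod] at hi ⊢
  rw [MeasureTheory.setIntegral_prod _ hi]
  simp only [h1, MeasureTheory.setIntegral_const, smul_eq_mul]
  rw [Real.volume_real_Icc_of_le r.left_lt_right.le]
  rfl

namespace RectTiling

variable {R : PlaneRect}

/-- Both sides are the integral of `p'(y)` over `R`, on the left computed tile by tile. -/
theorem sum_width_mul_eval_sub (T : RectTiling R) (p : Polynomial ℝ) :
    ∑ r ∈ T.tiles, r.width * (p.eval r.top - p.eval r.bottom) =
      R.width * (p.eval R.top - p.eval R.bottom) := by
  have hc : Continuous fun z : ℝ × ℝ => p.derivative.eval z.2 := by fun_prop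
  have hi : ∀ r : PlaneRect,
      MeasureTheory.IntegrableOn (fun z : ℝ × ℝ => p.derivative.eval z.2) r.toSet :=
    fun r => hc.continuousOn.integrableOn_compact r.isCompact_toSet
  have hU : (⋃ r : {r // r ∈ T.tiles}, r.1.toSet) = R.toSet := by
    rw [← T.iUnion_eq, Set.iUnion_subtype]
  have hs := MeasureTheory.hasSum_integral_iUnion_ae
    (f := fun z : ℝ × ℝ => p.derivative.eval z.2) (μ := MeasureTheory.volume)
    (s := fun r : {r // r ∈ T.tiles} => r.1.toSet)
    (fun r => r.1.isCompact_toSet.measurableSet.nullMeasurableSet)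
    (fun r r' h => PlaneRect.aedisjoint
      (T.interior_disjoint _ r.2 _ r'.2 fun h' => h (Subtype.ext h')))
    (by rw [hU]; exact hi R)
  rw [hU] at hs
  have := hs.unique (hasSum_fintype _)
  simp only [PlaneRect.integral_derivative] at this
  rw [this, ← Finset.sum_coe_sort]

/-- Kirchhoff's law for the tiling: the total flux of any potential on the horizontal lines. -/
theorem sum_width_mul_sub (T : RectTiling R) (g : ℝ → ℝ) :
    ∑ r ∈ T.tiles, r.width * (g r.top - g r.bottom) = R.width * (g R.top - g R.bottom) := by
  -- Only the values of `g` on the finite set `T.lines` matter, so an interpolating polynomial may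
  -- replace it.
  have hp : ∀ y ∈ T.lines, (Lagrange.interpolate T.lines id g).eval y = g y := fun y hy =>
    Lagrange.eval_interpolate_at_node g (Function.injective_id.injOn) hy
  have h := T.sum_width_mul_eval_sub (Lagrange.interpolate T.lines id g)
  rw [hp _ T.top_mem_lines, hp _ T.bottom_mem_lines] at h
  rw [← h]
  refine Finset.sum_congr rfl fun r hr => ?_
  rw [hp _ (Finset.mem_union_left _ (Finset.mem_image_of_mem _ hr)),
    hp _ (Finset.mem_union_right _ (Finset.mem_image_of_mem _ hr))]

theorem sum_width_mul_height (T : RectTiling R) :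
    ∑ r ∈ T.tiles, r.width * r.height = R.width * R.height :=
  T.sum_width_mul_sub id

/-- The slope is `d / R.height` on every tile, so each tile contributes its area times the squared
slope. -/
theorem energy_affine (T : RectTiling R) (c d : ℝ) :
    ∑ r ∈ T.tiles, r.width / r.height *
      ((c + (r.top - R.bottom) / R.height * d) - (c + (r.bottom - R.bottom) / R.height * d)) ^ 2 =
      R.width / R.height * d ^ 2 := by
  have hR : R.height ≠ 0 := (sub_pos.2 R.bottom_lt_top).ne'
  have h : ∀ r ∈ T.tiles, r.width / r.height *
      ((c + (r.top - R.bottom) / R.height * d) -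
        (c + (r.bottom - R.bottom) / R.height * d)) ^ 2 =
      r.width * r.height * (d / R.height) ^ 2 := by
    intro r _
    have hr : r.height ≠ 0 := (sub_pos.2 r.bottom_lt_top).ne'
    have : (c + (r.top - R.bottom) / R.height * d) -
        (c + (r.bottom - R.bottom) / R.height * d) = r.height * (d / R.height) := by
      unfold PlaneRect.height
      ring
    rw [this]
    field_simp
  rw [Finset.sum_congr rfl h, ← Finset.sum_mul, T.sum_width_mul_height]
  field_simp

/-- On each tile, expand the nonnegative energy of `g` minus the affine potential of the same total
rise. Kirchhoff's law evaluates the sum of the cross terms. -/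
theorem le_energy (T : RectTiling R) (g : ℝ → ℝ) :
    R.width / R.height * (g R.top - g R.bottom) ^ 2 ≤
      ∑ r ∈ T.tiles, r.width / r.height * (g r.top - g r.bottom) ^ 2 := by
  have hR : R.height ≠ 0 := (sub_pos.2 R.bottom_lt_top).ne'
  set c : ℝ := (g R.top - g R.bottom) / R.height with hc
  have h : ∀ r ∈ T.tiles, 2 * c * (r.width * (g r.top - g r.bottom)) -
      c ^ 2 * (r.width * r.height) ≤ r.width / r.height * (g r.top - g r.bottom) ^ 2 := by
    intro r _
    have hr : 0 < r.height := sub_pos.2 r.bottom_lt_top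
    have hw : 0 < r.width := sub_pos.2 r.left_lt_right
    have : r.width / r.height * (g r.top - g r.bottom) ^ 2 -
        (2 * c * (r.width * (g r.top - g r.bottom)) - c ^ 2 * (r.width * r.height)) =
        r.width / r.height * (g r.top - g r.bottom - c * r.height) ^ 2 := by
      field_simp
      ring
    have h0 : 0 ≤ r.width / r.height * (g r.top - g r.bottom - c * r.height) ^ 2 := by positivity
    linarith
  refine le_trans (le_of_eq ?_) (Finset.sum_le_sum h)
  rw [Finset.sum_sub_distrib, ← Finset.mul_sum, ← Finset.mul_sum, T.sum_width_mul_sub,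
    T.sum_width_mul_height, hc]
  field_simp
  ring

end RectTiling

/-! ### Diagonalization and dimension counting. -/

theorem IsOrderedEigenvalueList.unique {V : Type*} [Finite V] {L : (V → ℝ) →ₗ[ℝ] (V → ℝ)} {n : ℕ}
    {ev ev' : Fin n → ℝ} (h : IsOrderedEigenvalueList L ev) (h' : IsOrderedEigenvalueList L ev') :
    ev = ev' := by
  have hr := congrArg Polynomial.roots (h.2.symm.trans h'.2)
  have hroots : ∀ u : Fin n → ℝ, (∏ i, (Polynomial.X - Polynomial.C (u i))).roots =
      (List.ofFn u : Multiset ℝ) := by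
    intro u
    rw [Polynomial.roots_prod _ _
      (Finset.prod_ne_zero_iff.2 fun i _ => Polynomial.X_sub_C_ne_zero _)]
    simp [Fin.univ_val_map]
  rw [hroots, hroots, Multiset.coe_eq_coe] at hr
  exact List.ofFn_injective (hr.eq_of_pairwise (fun _ _ _ _ => le_antisymm)
    h.1.sortedLE_ofFn.pairwise h'.1.sortedLE_ofFn.pairwise)

/-- A linear operator that is symmetric for a weighted inner product has an ordered list of
eigenvalues, and any such list diagonalizes it in orthonormal coordinates. -/
theorem exists_isOrderedEigenvalueList {X : Type*} [Fintype X] (m : X → ℝ) (hm : ∀ x, 0 < m x)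
    (L : (X → ℝ) →ₗ[ℝ] (X → ℝ))
    (hL : ∀ f g, ∑ x, m x * (f x * L g x) = ∑ x, m x * (L f x * g x)) {n : ℕ}
    (hn : n = Fintype.card X) :
    ∃ ev : Fin n → ℝ, IsOrderedEigenvalueList L ev ∧
      ∃ c : (X → ℝ) →ₗ[ℝ] (Fin n → ℝ), (∀ f, ∑ x, m x * f x ^ 2 = ∑ i, c f i ^ 2) ∧
        ∀ f, ∑ x, m x * (f x * L f x) = ∑ i, ev i * c f i ^ 2 := by
  -- Scaling by `√m` is an isometry from the weighted space to the Euclidean one.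
  let Φ : (X → ℝ) ≃ₗ[ℝ] EuclideanSpace ℝ X :=
    (LinearEquiv.piCongrRight fun x =>
      LinearEquiv.smulOfNeZero ℝ ℝ (Real.sqrt (m x)) (Real.sqrt_pos.2 (hm x)).ne').trans
      (WithLp.linearEquiv 2 ℝ (X → ℝ)).symm
  have hΦ : ∀ f x, Φ f x = Real.sqrt (m x) * f x := fun f x => rfl
  have hin : ∀ f g, inner ℝ (Φ f) (Φ g) = ∑ x, m x * (f x * g x) := by
    intro f g
    rw [PiLp.inner_apply]
    refine Finset.sum_congr rfl fun x _ => ?_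
    rw [hΦ, hΦ]
    rw [RCLike.inner_apply, conj_trivial]
    linear_combination (f x * g x) * Real.mul_self_sqrt (hm x).le
  let S : EuclideanSpace ℝ X →ₗ[ℝ] EuclideanSpace ℝ X := Φ.conj L
  have hSΦ : ∀ f, S (Φ f) = Φ (L f) := fun f => by simp [S, LinearEquiv.conj_apply]
  have hS : S.IsSymmetric := by
    intro u v
    obtain ⟨f, rfl⟩ := Φ.surjective u
    obtain ⟨g, rfl⟩ := Φ.surjective v
    rw [hSΦ, hSΦ, hin, hin, hL]
  have hd : Module.finrank ℝ (EuclideanSpace ℝ X) = n := by rw [finrank_euclideanSpace, hn]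
  let b := hS.eigenvectorBasis hd
  -- `eigenvalues` is decreasing, hence the reversed indices.
  refine ⟨fun i => hS.eigenvalues hd i.rev, ⟨?_, ?_⟩,
    { toFun := fun f i => b.repr (Φ f) i.rev
      map_add' := fun f g => by ext; simp
      map_smul' := fun r f => by ext; simp }, ?_, ?_⟩
  · exact fun i j h => hS.eigenvalues_antitone hd (Fin.rev_le_rev.2 h)
  · rw [← LinearEquiv.charpoly_conj Φ L, hS.charpoly_eq hd]
    exact (Equiv.prod_comp Fin.revPerm
      fun i => (Polynomial.X - Polynomial.C (hS.eigenvalues hd i))).symm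
  · intro f
    have h := b.repr.inner_map_map (Φ f) (Φ f)
    rw [hin, PiLp.inner_apply] at h
    simp only [pow_two]
    rw [← h, ← Equiv.sum_comp Fin.revPerm]
    rfl
  · intro f
    have h := b.repr.inner_map_map (Φ f) (S (Φ f))
    rw [hSΦ, hin, PiLp.inner_apply] at h
    rw [← h, ← Equiv.sum_comp Fin.revPerm]
    refine Finset.sum_congr rfl fun i _ => ?_
    have h1 := hS.eigenvectorBasis_apply_self_apply hd (Φ f) i.rev
    rw [hSΦ] at h1
    change inner ℝ (b.repr (Φ f) i.rev) (b.repr (Φ (L f)) i.rev) = _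
    change b.repr (Φ (L f)) i.rev = _ at h1
    rw [h1]
    rw [RCLike.inner_apply, conj_trivial, RCLike.ofReal_real_eq_id, id]
    change hS.eigenvalues hd i.rev * b.repr (Φ f) i.rev * b.repr (Φ f) i.rev =
      hS.eigenvalues hd i.rev * b.repr (Φ f) i.rev ^ 2
    ring

/-- Fewer linear conditions than dimensions have a common nonzero solution. -/
theorem exists_ne_zero_of_card_lt {U : Type*} [AddCommGroup U] [Module ℝ U]
    [FiniteDimensional ℝ U] {p q : ℕ} (c : U →ₗ[ℝ] (Fin p → ℝ)) (d : U →ₗ[ℝ] (Fin q → ℝ))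
    (A : Finset (Fin p)) (B : Finset (Fin q)) (h : A.card + B.card < Module.finrank ℝ U) :
    ∃ f : U, f ≠ 0 ∧ (∀ i ∈ A, c f i = 0) ∧ ∀ j ∈ B, d f j = 0 := by
  let Ψ : U →ₗ[ℝ] (A → ℝ) × (B → ℝ) :=
    ((LinearMap.funLeft ℝ ℝ Subtype.val).comp c).prod ((LinearMap.funLeft ℝ ℝ Subtype.val).comp d)
  have hk : LinearMap.ker Ψ ≠ ⊥ := LinearMap.ker_ne_bot_of_finrank_lt (by
    simpa using h)
  obtain ⟨f, hf, h0⟩ := Submodule.exists_mem_ne_zero_of_ne_bot hk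
  have hf' : Ψ f = 0 := hf
  refine ⟨f, h0, fun i hi => ?_, fun j hj => ?_⟩
  · exact congrFun (congrArg Prod.fst hf') ⟨i, hi⟩
  · exact congrFun (congrArg Prod.snd hf') ⟨j, hj⟩

theorem sum_mul_sq_le {n : ℕ} {ev : Fin n → ℝ} (h : Monotone ev) (i : Fin n) {c : Fin n → ℝ}
    (hc : ∀ j ∈ Finset.Ioi i, c j = 0) : ∑ j, ev j * c j ^ 2 ≤ ev i * ∑ j, c j ^ 2 := by
  rw [Finset.mul_sum]
  refine Finset.sum_le_sum fun j _ => ?_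
  rcases le_or_gt j i with hj | hj
  · exact mul_le_mul_of_nonneg_right (h hj) (sq_nonneg _)
  · simp [hc j (Finset.mem_Ioi.2 hj)]

theorem le_sum_mul_sq {n : ℕ} {ev : Fin n → ℝ} (h : Monotone ev) (i : Fin n) {c : Fin n → ℝ}
    (hc : ∀ j ∈ Finset.Iio i, c j = 0) : ev i * ∑ j, c j ^ 2 ≤ ∑ j, ev j * c j ^ 2 := by
  rw [Finset.mul_sum]
  refine Finset.sum_le_sum fun j _ => ?_
  rcases le_or_gt i j with hj | hj
  · exact mul_le_mul_of_nonneg_right (h hj) (sq_nonneg _)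
  · simp [hc j (Finset.mem_Iio.2 hj)]

/-! ### Energy, mass and comparison of eigenvalues. -/

namespace WeightedMultigraph

variable {V E : Type*} [Fintype V] [DecidableEq V] [Fintype E]

/-- Green's formula. -/
theorem sum_vertexWeight_mul_laplacian (G : WeightedMultigraph V E) (f g : V → ℝ) :
    ∑ v, G.vertexWeight v * (f v * G.laplacian g v) =
      ∑ e, G.edgeWeight e * ((f (G.tgt e) - f (G.src e)) * (g (G.tgt e) - g (G.src e))) := by
  have h : ∀ v, G.vertexWeight v * (f v * G.laplacian g v) =
      ∑ e, ((if G.tgt e = v ∧ G.src e ≠ v then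
          f v * (G.edgeWeight e * (g (G.tgt e) - g (G.src e))) else 0) -
        (if G.src e = v ∧ G.tgt e ≠ v then
          f v * (G.edgeWeight e * (g (G.tgt e) - g (G.src e))) else 0)) := by
    intro v
    have hv := (G.vertexWeight_pos v).ne'
    simp only [laplacian, negDiv, grad, LinearMap.comp_apply, LinearMap.coe_mk, AddHom.coe_mk,
      ← Finset.sum_add_distrib, Finset.mul_sum]
    refine Finset.sum_congr rfl fun e _ => ?_
    split_ifs <;> field_simp <;> ring
  simp only [h]
  rw [Finset.sum_comm]
  refine Finset.sum_congr rfl fun e _ => ?_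
  rw [Finset.sum_sub_distrib]
  -- A loop contributes zero to both sides.
  by_cases hl : G.tgt e = G.src e
  · simp [hl]
  · have h1 : ∀ v, (G.tgt e = v ∧ G.src e ≠ v) ↔ G.tgt e = v :=
      fun v => ⟨And.left, fun h => ⟨h, fun h' => hl (h.trans h'.symm)⟩⟩
    have h2 : ∀ v, (G.src e = v ∧ G.tgt e ≠ v) ↔ G.src e = v :=
      fun v => ⟨And.left, fun h => ⟨h, fun h' => hl (h'.trans h.symm)⟩⟩
    simp only [h1, h2, Finset.sum_ite_eq, Finset.mem_univ, if_true]
    ring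

/-- The Dirichlet energy. -/
def energy {V E : Type*} [Fintype E] (G : WeightedMultigraph V E) (f : V → ℝ) : ℝ :=
  ∑ e, G.edgeWeight e * (f (G.tgt e) - f (G.src e)) ^ 2

theorem energy_nonneg {V E : Type*} [Fintype E] (G : WeightedMultigraph V E) (f : V → ℝ) : 0 ≤ G.energy f :=
  Finset.sum_nonneg fun e _ => mul_nonneg (G.edgeWeight_pos e).le (sq_nonneg _)

/-- The squared norm in `L²(V, υ)`. -/
def mass {V E : Type*} [Fintype V] (G : WeightedMultigraph V E) (f : V → ℝ) : ℝ :=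
  ∑ v, G.vertexWeight v * f v ^ 2

theorem mass_pos {V E : Type*} [Fintype V] (G : WeightedMultigraph V E) {f : V → ℝ} (hf : f ≠ 0) : 0 < G.mass f := by
  obtain ⟨v, hv⟩ := Function.ne_iff.1 hf
  refine Finset.sum_pos' (fun v _ => mul_nonneg (G.vertexWeight_pos v).le (sq_nonneg _))
    ⟨v, Finset.mem_univ v, mul_pos (G.vertexWeight_pos v) (sq_pos_iff.2 hv)⟩

theorem exists_eigenvalues (G : WeightedMultigraph V E) {n : ℕ} (hn : n = Fintype.card V) :
    ∃ ev : Fin n → ℝ, IsOrderedEigenvalueList G.laplacian ev ∧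
      ∃ c : (V → ℝ) →ₗ[ℝ] (Fin n → ℝ), (∀ f, G.mass f = ∑ i, c f i ^ 2) ∧
        ∀ f, G.energy f = ∑ i, ev i * c f i ^ 2 := by
  obtain ⟨ev, hev, c, hc, hc'⟩ := exists_isOrderedEigenvalueList G.vertexWeight
    G.vertexWeight_pos G.laplacian (fun f g => by
      simp only [mul_comm (G.laplacian f _), sum_vertexWeight_mul_laplacian]
      exact Finset.sum_congr rfl fun e _ => by ring) hn
  refine ⟨ev, hev, c, hc, fun f => ?_⟩
  rw [← hc' f, sum_vertexWeight_mul_laplacian]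
  exact Finset.sum_congr rfl fun e _ => by ring

/-- If a linear map between function spaces decreases energy and increases mass, then each
eigenvalue of the target is at most the one with the same index of the source. -/
theorem eigenvalue_le_of_energy_le {V' E' : Type*} [Fintype V'] [DecidableEq V'] [Fintype E']
    (G : WeightedMultigraph V E) (G' : WeightedMultigraph V' E') {n k : ℕ}
    (hn : n = Fintype.card V) (hk : n + k = Fintype.card V')
    (J : (V → ℝ) →ₗ[ℝ] (V' → ℝ)) (hJ : ∀ f, G'.energy (J f) ≤ G.energy f)
    (hJm : ∀ f, G.mass f ≤ G'.mass (J f)) {lam : Fin n → ℝ} {mu : Fin (n + k) → ℝ}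
    (hlam : IsOrderedEigenvalueList G.laplacian lam)
    (hmu : IsOrderedEigenvalueList G'.laplacian mu) (i : Fin n) :
    mu (Fin.castAdd k i) ≤ lam i := by
  obtain ⟨lam', h1, c, hc, hce⟩ := G.exists_eigenvalues hn
  obtain rfl := hlam.unique h1
  obtain ⟨mu', h2, d, hd, hde⟩ := G'.exists_eigenvalues hk
  obtain rfl := hmu.unique h2
  -- With zero-based `i`, there are `(n - 1 - i) + i = n - 1` conditions on an `n`-dimensional
  -- space.
  obtain ⟨f, hf, hA, hB⟩ := exists_ne_zero_of_card_lt c (d ∘ₗ J) (Finset.Ioi i)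
    (Finset.Iio (Fin.castAdd k i)) (by
      rw [Fin.card_Ioi, Fin.card_Iio, Module.finrank_fintype_fun_eq_card, ← hn]
      simp only [Fin.val_castAdd]
      omega)
  have ha := sum_mul_sq_le h1.1 i hA
  have hb := le_sum_mul_sq h2.1 _ hB
  rw [← hc, ← hce] at ha
  simp only [LinearMap.comp_apply] at hb
  rw [← hd, ← hde] at hb
  have hpos := G.mass_pos hf
  -- Multiplying the mass inequality by `mu` needs a sign; for negative `mu` the claim follows from
  -- `0 ≤ lam i`.
  rcases le_or_gt 0 (mu (Fin.castAdd k i)) with h0 | h0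
  · refine le_of_mul_le_mul_right ?_ hpos
    have := mul_le_mul_of_nonneg_left (hJm f) h0
    linarith [hJ f]
  · have := G.energy_nonneg f
    have : 0 ≤ lam i := nonneg_of_mul_nonneg_left (this.trans ha) hpos
    linarith

/-- If a linear map between function spaces increases energy and preserves mass, then each
eigenvalue of the source is at most the one of the target with the index shifted by the
difference of the dimensions. -/
theorem eigenvalue_le_of_le_energy {V' E' : Type*} [Fintype V'] [DecidableEq V'] [Fintype E']
    (G : WeightedMultigraph V E) (G' : WeightedMultigraph V' E') {n k : ℕ}
    (hn : n = Fintype.card V) (hk : n + k = Fintype.card V')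
    (J : (V → ℝ) →ₗ[ℝ] (V' → ℝ)) (hJ : ∀ f, G.energy f ≤ G'.energy (J f))
    (hJm : ∀ f, G'.mass (J f) = G.mass f) {lam : Fin n → ℝ} {mu : Fin (n + k) → ℝ}
    (hlam : IsOrderedEigenvalueList G.laplacian lam)
    (hmu : IsOrderedEigenvalueList G'.laplacian mu) (i : Fin n) :
    lam i ≤ mu (Fin.addNat i k) := by
  obtain ⟨lam', h1, c, hc, hce⟩ := G.exists_eigenvalues hn
  obtain rfl := hlam.unique h1
  obtain ⟨mu', h2, d, hd, hde⟩ := G'.exists_eigenvalues hk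
  obtain rfl := hmu.unique h2
  -- Now `i + (n + k - 1 - (i + k)) = n - 1` conditions. Since mass is preserved, no sign of an
  -- eigenvalue is needed.
  obtain ⟨f, hf, hA, hB⟩ := exists_ne_zero_of_card_lt c (d ∘ₗ J) (Finset.Iio i)
    (Finset.Ioi (Fin.addNat i k)) (by
      rw [Fin.card_Ioi, Fin.card_Iio, Module.finrank_fintype_fun_eq_card, ← hn]
      simp only [Fin.val_addNat]
      omega)
  have ha := le_sum_mul_sq h1.1 i hA
  have hb := sum_mul_sq_le h2.1 _ hB
  rw [← hc, ← hce] at ha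
  simp only [LinearMap.comp_apply] at hb
  rw [← hd, ← hde, hJm] at hb
  exact le_of_mul_le_mul_right (by linarith [hJ f]) (G.mass_pos hf)

end WeightedMultigraph

/-! ### Energy and mass after replacing an edge. -/

namespace WeightedMultigraph

theorem energy_replaceEdge {V E : Type*} [Fintype V] [DecidableEq V] [Fintype E] [DecidableEq E]
    {U D : Type*} [Fintype U] [DecidableEq U] [Fintype D]
    (G : WeightedMultigraph V E) (e : E) (a b : V)
    (H : WeightedMultigraph U D) (s t : U)
    (w : {x : U // x ≠ s ∧ x ≠ t} → ℝ) (hw : ∀ x, 0 < w x)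
    (g : V ⊕ {x : U // x ≠ s ∧ x ≠ t} → ℝ) :
    (G.replaceEdge e a b H s t w hw).energy g =
      (∑ f : {f : E // f ≠ e}, G.edgeWeight f *
        (g (Sum.inl (G.tgt f)) - g (Sum.inl (G.src f))) ^ 2) +
      ∑ d, H.edgeWeight d * (g (glue a b s t (H.tgt d)) - g (glue a b s t (H.src d))) ^ 2 := by
  unfold energy
  rw [Fintype.sum_sum_type]
  rfl

theorem mass_replaceEdge {V E : Type*} [Fintype V] [DecidableEq V] [Fintype E] [DecidableEq E]
    {U D : Type*} [Fintype U] [DecidableEq U] [Fintype D]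
    (G : WeightedMultigraph V E) (e : E) (a b : V)
    (H : WeightedMultigraph U D) (s t : U)
    (w : {x : U // x ≠ s ∧ x ≠ t} → ℝ) (hw : ∀ x, 0 < w x)
    (g : V ⊕ {x : U // x ≠ s ∧ x ≠ t} → ℝ) :
    (G.replaceEdge e a b H s t w hw).mass g =
      G.mass (fun v => g (Sum.inl v)) + ∑ x, w x * g (Sum.inr x) ^ 2 := by
  unfold mass
  rw [Fintype.sum_sum_type]
  rfl

theorem energy_eq_add {V E : Type*} [Fintype V] [Fintype E] [DecidableEq E]
    (G : WeightedMultigraph V E) {e : E} {a b : V} (hab : s(G.src e, G.tgt e) = s(a, b))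
    (f : V → ℝ) :
    G.energy f = (∑ d : {d : E // d ≠ e}, G.edgeWeight d *
        (f (G.tgt d) - f (G.src d)) ^ 2) + G.edgeWeight e * (f b - f a) ^ 2 := by
  have h : (f (G.tgt e) - f (G.src e)) ^ 2 = (f b - f a) ^ 2 := by
    rcases Sym2.eq_iff.1 hab with ⟨h1, h2⟩ | ⟨h1, h2⟩
    · rw [h1, h2]
    · rw [h1, h2]
      ring
  rw [← h]
  unfold energy
  rw [← Finset.sum_erase_add _ _ (Finset.mem_univ e)]
  congr 1
  exact Finset.sum_subtype _ (by simp) _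

end WeightedMultigraph

/-! ### The affine and zero extensions. -/

namespace RectTiling

variable {R : PlaneRect} {V : Type*}

theorem topVertex_ne_bottomVertex (T : RectTiling R) : T.topVertex ≠ T.bottomVertex :=
  fun h => R.bottom_lt_top.ne' (congrArg Subtype.val h)

theorem sum_graph (T : RectTiling R) (h : {y : ℝ // y ∈ T.lines} → ℝ) (h' : ℝ → ℝ)
    (hh : ∀ y, h y = h' y) :
    ∑ d, T.graph.edgeWeight d * (h (T.graph.tgt d) - h (T.graph.src d)) ^ 2 =
      ∑ r ∈ T.tiles, r.width / r.height * (h' r.top - h' r.bottom) ^ 2 := by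
  rw [← Finset.sum_coe_sort T.tiles]
  refine Finset.sum_congr rfl fun r _ => ?_
  rw [hh, hh]
  rfl

/-- Extend a function to the new vertices by affine interpolation in the height. -/
noncomputable def affineExtension (T : RectTiling R) (a b : V) :
    (V → ℝ) →ₗ[ℝ] (V ⊕ T.NewVertex → ℝ) where
  toFun f := Sum.elim f fun x => f a + (x.1.1 - R.bottom) / R.height * (f b - f a)
  map_add' f g := by
    ext (v | x)
    · rfl
    · simp only [Sum.elim_inr, Pi.add_apply]
      ring
  map_smul' c f := by
    ext (v | x)
    · rfl
    · simp only [Sum.elim_inr, Pi.smul_apply, smul_eq_mul, RingHom.id_apply]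
      ring

/-- Extend a function by zero to the new vertices. -/
def zeroExtension (T : RectTiling R) : (V → ℝ) →ₗ[ℝ] (V ⊕ T.NewVertex → ℝ) where
  toFun f := Sum.elim f 0
  map_add' f g := by
    ext (v | x) <;> simp
  map_smul' c f := by
    ext (v | x) <;> simp

/-- The interpolation formula takes the values `f a` and `f b` at the bottom and top of `R`, so it
also holds at the glued vertices. -/
theorem affineExtension_glue (T : RectTiling R) (a b : V) (f : V → ℝ)
    (y : {y : ℝ // y ∈ T.lines}) :
    T.affineExtension a b f
      (WeightedMultigraph.glue a b T.bottomVertex T.topVertex y) =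
      f a + (y - R.bottom) / R.height * (f b - f a) := by
  have hR : R.height ≠ 0 := (sub_pos.2 R.bottom_lt_top).ne'
  unfold WeightedMultigraph.glue
  split_ifs with hs ht
  · rw [hs]
    change f a = f a + (R.bottom - R.bottom) / R.height * (f b - f a)
    ring
  · rw [ht]
    change f b = f a + R.height / R.height * (f b - f a)
    field_simp
    ring
  · rfl

section Replacement

variable {E : Type*} [Fintype V] [DecidableEq V] [Fintype E] [DecidableEq E]
  (T : RectTiling R) (G : WeightedMultigraph V E) {e : E} {a b : V}
  (w : T.NewVertex → ℝ) (hw : ∀ x, 0 < w x)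

theorem energy_affineExtension (hab : s(G.src e, G.tgt e) = s(a, b))
    (hR : G.edgeWeight e = R.width / R.height) (f : V → ℝ) :
    (G.replaceEdge e a b T.graph T.bottomVertex T.topVertex w hw).energy
      (T.affineExtension a b f) = G.energy f := by
  rw [WeightedMultigraph.energy_replaceEdge, G.energy_eq_add hab,
    T.sum_graph (fun y => T.affineExtension a b f (WeightedMultigraph.glue a b _ _ y))
      (fun y => f a + (y - R.bottom) / R.height * (f b - f a)) (T.affineExtension_glue a b f),
    T.energy_affine, hR]
  rfl

theorem energy_le_energy_zeroExtension (hab : s(G.src e, G.tgt e) = s(a, b))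
    (hR : G.edgeWeight e = R.width / R.height) (f : V → ℝ) :
    G.energy f ≤ (G.replaceEdge e a b T.graph T.bottomVertex T.topVertex w hw).energy
      (T.zeroExtension f) := by
  classical
  let h : {y : ℝ // y ∈ T.lines} → ℝ := fun y =>
    T.zeroExtension f (WeightedMultigraph.glue a b T.bottomVertex T.topVertex y)
  -- `le_energy` takes a potential on all of `ℝ`; the value 0 off `T.lines` never enters its sums.
  let h' : ℝ → ℝ := fun y => if hy : y ∈ T.lines then h ⟨y, hy⟩ else 0
  have hh : ∀ y, h y = h' y := fun y => by simp [h', y.2]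
  have hb : h' R.bottom = f a := by
    refine (hh T.bottomVertex).symm.trans ?_
    simp [h, WeightedMultigraph.glue, zeroExtension]
  have ht : h' R.top = f b := by
    refine (hh T.topVertex).symm.trans ?_
    simp [h, WeightedMultigraph.glue, zeroExtension, T.topVertex_ne_bottomVertex]
  rw [WeightedMultigraph.energy_replaceEdge, G.energy_eq_add hab, T.sum_graph h h' hh, hR,
    ← hb, ← ht]
  exact add_le_add_right (T.le_energy h') _

theorem mass_le_mass_affineExtension (f : V → ℝ) :
    G.mass f ≤ (G.replaceEdge e a b T.graph T.bottomVertex T.topVertex w hw).mass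
      (T.affineExtension a b f) := by
  rw [WeightedMultigraph.mass_replaceEdge]
  exact le_add_of_nonneg_right (Finset.sum_nonneg fun x _ => mul_nonneg (hw x).le (sq_nonneg _))

theorem mass_zeroExtension (f : V → ℝ) :
    (G.replaceEdge e a b T.graph T.bottomVertex T.topVertex w hw).mass
      (T.zeroExtension f) = G.mass f := by
  rw [WeightedMultigraph.mass_replaceEdge]
  simp [zeroExtension]

end Replacement

end RectTiling

theorem theorem6p2 {V E : Type*} [Fintype V] [DecidableEq V] [Fintype E] [DecidableEq E]
    (G : WeightedMultigraph V E) (e : E) (a b : V) (hab : s(G.src e, G.tgt e) = s(a, b))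
    (R : PlaneRect) (hR : G.edgeWeight e = R.width / R.height) (T : RectTiling R)
    (w : T.NewVertex → ℝ) (hw : ∀ x, 0 < w x)
    (n k : ℕ) (hn : n = Fintype.card V) (hk : k = Fintype.card T.NewVertex)
    (G' : WeightedMultigraph (V ⊕ T.NewVertex)
      ({f : E // f ≠ e} ⊕ {r : PlaneRect // r ∈ T.tiles}))
    (hG' : G' = G.replaceEdge e a b T.graph T.bottomVertex T.topVertex w hw) :
    (∃ lam : Fin n → ℝ, IsOrderedEigenvalueList G.laplacian lam) ∧
    (∃ mu : Fin (n + k) → ℝ, IsOrderedEigenvalueList G'.laplacian mu) ∧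
    ∀ (lam : Fin n → ℝ) (mu : Fin (n + k) → ℝ),
      IsOrderedEigenvalueList G.laplacian lam → IsOrderedEigenvalueList G'.laplacian mu →
      ∀ i : Fin n, mu (Fin.castAdd k i) ≤ lam i ∧ lam i ≤ mu (Fin.addNat i k) := by
  subst hG'
  have hc : n + k = Fintype.card (V ⊕ T.NewVertex) := by rw [Fintype.card_sum, hn, hk]
  refine ⟨?_, ?_, fun lam mu hlam hmu i => ⟨?_, ?_⟩⟩
  · obtain ⟨ev, h, -⟩ := G.exists_eigenvalues hn
    exact ⟨ev, h⟩
  · obtain ⟨ev, h, -⟩ := WeightedMultigraph.exists_eigenvalues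
      (G.replaceEdge e a b T.graph T.bottomVertex T.topVertex w hw) hc
    exact ⟨ev, h⟩
  · exact G.eigenvalue_le_of_energy_le _ hn hc (T.affineExtension a b)
      (fun f => (T.energy_affineExtension G w hw hab hR f).le)
      (T.mass_le_mass_affineExtension G w hw) hlam hmu i
  · exact G.eigenvalue_le_of_le_energy _ hn hc T.zeroExtension
      (T.energy_le_energy_zeroExtension G w hw hab hR)
      (T.mass_zeroExtension G w hw) hlam hmu i
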